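/- Let $X$ be a complete metric linear space, i.e. a real vector space with a complete translation-invariant metric with respect to which scalar multiplication $\mathbb{R}\times X\to X$ is continuous. A set $A\subseteq X$ is a uBP-set (has the universal Baire property) if for every continuous map $g:K\to X$ from a compact metrizable space $K$ the preimage $g^{-1}(A)$ has the Baire property in $K$, i.e. there is an open set $U\subseteq K$ such that the symmetric difference $U\,\triangle\, g^{-1}(A)$ is meager in $K$. A uBP-set $A\subseteq X$ is Haar-meager in $X$ if there exists a continuous map $g:K\to X$ from a non-empty compact metrizable space $K$ such that $g^{-1}(x+A)$ is meager in $K$ for all $x\in X$. Let $G\subseteq X$ be a non-empty open convex set and let $f:G\to\mathbb{R}$ be mid-point convex, i.e. $f(\tfrac12 x+\tfrac12 y)\le \tfrac12 f(x)+\tfrac12 f(y)$ for all $x,y\in G$. Then $f$ is continuous if and only if $f$ is upper bounded on some uBP-set $B\subseteq G$ which is not Haar-meager in $X$. -/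

import Mathlib

/-- A subset `A` of a topological space `X` has the *universal Baire property* (is a *uBP-set*) if
for every continuous map `g : K → X` from a compact metrizable space `K` the preimage `g ⁻¹' A` has
the Baire property in `K`, i.e. differs from an open set by a meager set
(see `BaireMeasurableSet.iff_residualEq_isOpen`).
A compact metrizable space is homeomorphic to a closed subspace of the Hilbert cube, so letting
`K` range over `Type` covers all of them. -/
def HasUniversalBaireProperty {X : Type*} [TopologicalSpace X] (A : Set X) : Prop :=
  ∀ (K : Type) [TopologicalSpace K] [CompactSpace K] [TopologicalSpace.MetrizableSpace K]
    (g : K → X), Continuous g → BaireMeasurableSet (g ⁻¹' A)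

/-- A uBP-set `A` of an Abelian topological group `X` is *Haar-meager* if there is a continuous map
`g : K → X` from a non-empty compact metrizable space `K` such that `g ⁻¹' (x + A)` is meager in
`K` for all `x : X`. (The notion is only used for uBP-sets.) -/
def IsHaarMeager {X : Type*} [TopologicalSpace X] [AddCommGroup X] (A : Set X) : Prop :=
  ∃ (K : Type) (_ : TopologicalSpace K) (_ : CompactSpace K)
    (_ : TopologicalSpace.MetrizableSpace K) (_ : Nonempty K) (g : K → X),
    Continuous g ∧ ∀ x : X, IsMeagre (g ⁻¹' ((fun a => x + a) '' A))

/-- A real function `f` is *mid-point convex* on `G` if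
`f (x/2 + y/2) ≤ f x / 2 + f y / 2` for all `x, y ∈ G`. -/
def IsMidpointConvexOn {X : Type*} [AddCommGroup X] [Module ℝ X] (G : Set X) (f : X → ℝ) : Prop :=
  ∀ x ∈ G, ∀ y ∈ G,
    f ((1 / 2 : ℝ) • x + (1 / 2 : ℝ) • y) ≤ (1 / 2 : ℝ) * f x + (1 / 2 : ℝ) * f y

open Filter Topology

/-! If `f` is unbounded above near `c`, choose `z n k` with `f (z n k) > k` so close to `c` that the
sequences `2 ^ n • (z n k - c)` are null in `k` and summably small in `n`. Summing one term from
each sequence maps the compact space `ℕ → ℕ∞` into `X`. Since `B` is not Haar-meager, some translate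
of `B` has nonmeager preimage, hence is comeager in a box. As the box restricts finitely many
coordinates, for large `n` all terms of the `n`-th sequence are carried into `B` by one translation.
Then `z n k` is a convex combination of a point of `B` and a point of `G` independent of `k`, so `f
(z n k)` is bounded in `k`, a contradiction. Local upper boundedness gives continuity by
Bernstein–Doetsch. For the converse, a nonempty open subset of `G` on which `f` is bounded serves as
`B`. -/

theorem isOpenMap_update_of_isOpen_singleton {ι : Type*} [DecidableEq ι] {A : ι → Type*}
    [∀ i, TopologicalSpace (A i)] (i : ι) {a : A i} (ha : IsOpen {a}) :
    IsOpenMap fun b : ∀ i, A i => Function.update b i a := by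
  intro s hs
  rw [isOpen_iff_mem_nhds]
  rintro _ ⟨b, hb, rfl⟩
  have h1 : IsOpen {q : ∀ i, A i | q i ∈ ({a} : Set (A i))} := ha.preimage (continuous_apply i)
  -- Nearby `q` have `q i = a`, so resetting coordinate `i` to `b i` gives a preimage of `q`, lying
  -- in `s`.
  have h2 : IsOpen {q : ∀ i, A i | Function.update q i (b i) ∈ s} :=
    hs.preimage (continuous_id.update i continuous_const)
  filter_upwards [h1.mem_nhds (by simp), h2.mem_nhds (by simpa using hb)] with q hq hq'
  refine ⟨_, hq', ?_⟩
  have hq : q i = a := hq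
  simp [← hq]

theorem continuous_enat_extend_zero {X : Type*} [NormedAddCommGroup X] {y : ℕ → X}
    (hy : Tendsto y atTop (𝓝 0)) :
    Continuous fun a : ℕ∞ => if a = ⊤ then (0 : X) else y a.toNat := by
  rw [continuous_iff_continuousAt]
  intro a
  by_cases ha : a = ⊤
  · subst ha
    simp only [ContinuousAt, if_true]
    rw [Metric.tendsto_nhds]
    intro ε hε
    obtain ⟨N, hN⟩ := eventually_atTop.1 (Metric.tendsto_nhds.1 hy ε hε)
    filter_upwards [Ioi_mem_nhds (ENat.natCast_lt_top N)] with b hb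
    split_ifs with h
    · simpa using hε
    · lift b to ℕ using h
      exact hN b (Nat.cast_lt.1 (Set.mem_Ioi.1 hb)).le
  · rw [ContinuousAt, ENat.nhds_eq_pure ha]
    exact tendsto_pure_nhds _ _

/-- If `B` is a uBP-set that is not Haar-meager and `y n` are null-sequences of uniformly summable
size, then, up to a convergent correction, all but finitely many of them are translated into `B`. -/
theorem exists_eventually_forall_add_mem_of_not_isHaarMeager {X : Type*} [NormedAddCommGroup X]
    [CompleteSpace X] {B : Set X} (hB : HasUniversalBaireProperty B) (hBm : ¬ IsHaarMeager B)
    {y : ℕ → ℕ → X} {u : ℕ → ℝ} (hu : Summable u) (hyu : ∀ n k, ‖y n k‖ ≤ u n)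
    (hy : ∀ n, Tendsto (y n) atTop (𝓝 0)) :
    ∃ (x : X) (d : ℕ → X), (∀ n, ‖d n‖ ≤ u n) ∧ ∀ᶠ n in atTop, ∀ k, x - d n + y n k ∈ B := by
  let Y : ℕ → ℕ∞ → X := fun n a => if a = ⊤ then 0 else y n a.toNat
  have hYc : ∀ n, Continuous (Y n) := fun n => continuous_enat_extend_zero (hy n)
  have hYu : ∀ n a, ‖Y n a‖ ≤ u n := by
    intro n a
    simp only [Y]
    split_ifs
    · simpa using (norm_nonneg _).trans (hyu n 0)
    · exact hyu n _
  have hYs : ∀ b : ℕ → ℕ∞, Summable fun n => Y n (b n) := fun b =>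
    Summable.of_norm_bounded hu fun n => hYu n (b n)
  let g : (ℕ → ℕ∞) → X := fun b => ∑' n, Y n (b n)
  have hg : Continuous g :=
    continuous_tsum (fun n => (hYc n).comp (continuous_apply n)) hu fun n b => hYu n (b n)
  have hupd : ∀ (b : ℕ → ℕ∞) (n k : ℕ),
      g (Function.update b n (k : ℕ∞)) = g b - Y n (b n) + y n k := by
    intro b n k
    have h := (hYs (Function.update b n (k : ℕ∞))).tsum_sub (hYs b)
    rw [tsum_eq_single n (by intro m hm; simp [Function.update_of_ne hm])] at h
    have h' : Y n ((k : ℕ∞)) = y n k := by simp [Y]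
    rw [Function.update_self, h'] at h
    change y n k - Y n (b n) = g _ - g b at h
    rw [sub_add_eq_add_sub, add_sub_assoc, h, add_sub_cancel]
  have : ∃ x : X, ¬ IsMeagre (g ⁻¹' ((fun a => x + a) '' B)) := by
    by_contra! h
    exact hBm ⟨ℕ → ℕ∞, inferInstance, inferInstance, inferInstance, inferInstance, g, hg, h⟩
  obtain ⟨x, hx⟩ := this
  have hS : g ⁻¹' ((fun a => x + a) '' B) = (fun b => -x + g b) ⁻¹' B := by
    rw [Set.image_add_left]; rfl
  rw [hS] at hx
  obtain ⟨U, hU, hSU⟩ := (hB (ℕ → ℕ∞) (fun b => -x + g b)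
    (continuous_const.add hg)).residualEq_isOpen
  have hUne : U.Nonempty := by
    by_contra hne
    rw [Set.not_nonempty_iff_eq_empty] at hne
    subst hne
    exact hx (by rw [IsMeagre]; filter_upwards [hSU.mem_iff] with b hb h using hb.1 h)
  obtain ⟨a, ha⟩ := hUne
  obtain ⟨I, t, ht, htU⟩ := isOpen_pi_iff.1 hU a ha
  -- Finite `k` is isolated in `ℕ∞`, so fixing coordinate `n` to `k` is an open map and pulls
  -- residual sets back to residual sets. With only countably many pairs `(n, k)`, one `b` serves
  -- them all.
  have hres : ∀ n k : ℕ, ∀ᶠ b : ℕ → ℕ∞ in residual _,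
      (Function.update b n (k : ℕ∞) ∈ (fun b => -x + g b) ⁻¹' B ↔
        Function.update b n (k : ℕ∞) ∈ U) := fun n k =>
    (tendsto_residual_of_isOpenMap (continuous_id.update n continuous_const)
      (isOpenMap_update_of_isOpen_singleton n
        (ENat.isOpen_singleton (ENat.natCast_ne_top k)))).eventually hSU.mem_iff
  have hall := eventually_countable_forall.2 fun n => eventually_countable_forall.2 (hres n)
  obtain ⟨b, hbt, hb⟩ := (dense_of_mem_residual hall).inter_open_nonempty ((I : Set ℕ).pi t)
    (isOpen_set_pi I.finite_toSet fun i hi => (ht i hi).1) ⟨a, fun i hi => (ht i hi).2⟩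
  refine ⟨-x + g b, fun n => Y n (b n), fun n => hYu n _, ?_⟩
  have hI : ∀ᶠ n in atTop, n ∉ I := by
    rw [← Nat.cofinite_eq_atTop]
    exact I.finite_toSet.eventually_cofinite_notMem
  filter_upwards [hI] with n hn k
  have hmem : Function.update b n (k : ℕ∞) ∈ U := by
    refine htU fun i hi => ?_
    rw [Function.update_of_ne (by rintro rfl; exact hn hi)]
    exact hbt i hi
  have := (hb n k).2 hmem
  rw [Set.mem_preimage, hupd] at this
  convert this using 1
  abel

theorem IsMidpointConvexOn.dyadic_le {X : Type*} [AddCommGroup X] [Module ℝ X] {G : Set X}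
    {f : X → ℝ} (hf : IsMidpointConvexOn G f) (hG : Convex ℝ G) {u v : X} (hu : u ∈ G)
    (hv : v ∈ G) (n : ℕ) :
    f (((1 / 2 : ℝ) ^ n) • u + (1 - (1 / 2 : ℝ) ^ n) • v) ≤
      (1 / 2 : ℝ) ^ n * f u + (1 - (1 / 2 : ℝ) ^ n) * f v := by
  induction n with
  | zero => simp
  | succ n ih =>
    have hp : (1 / 2 : ℝ) ^ n ≤ 1 := pow_le_one₀ (by norm_num) (by norm_num)
    have hw : ((1 / 2 : ℝ) ^ n) • u + (1 - (1 / 2 : ℝ) ^ n) • v ∈ G :=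
      hG hu hv (by positivity) (by linarith) (by ring)
    have h := hf _ hw _ hv
    have e : ((1 / 2 : ℝ) ^ (n + 1)) • u + (1 - (1 / 2 : ℝ) ^ (n + 1)) • v =
        (1 / 2 : ℝ) • (((1 / 2 : ℝ) ^ n) • u + (1 - (1 / 2 : ℝ) ^ n) • v) + (1 / 2 : ℝ) • v := by
      module
    rw [e, pow_succ]
    linarith

theorem IsMidpointConvexOn.exists_eventually_le {X : Type*} [NormedAddCommGroup X] [Module ℝ X]
    [ContinuousSMul ℝ X] [CompleteSpace X] {G : Set X} (hGo : IsOpen G) (hG : Convex ℝ G)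
    {f : X → ℝ} (hf : IsMidpointConvexOn G f) {B : Set X} (hBG : B ⊆ G)
    (hB : HasUniversalBaireProperty B) (hBm : ¬ IsHaarMeager B) (hfB : BddAbove (f '' B))
    (c : X) (hc : c ∈ G) : ∃ M, ∀ᶠ z in 𝓝 c, f z ≤ M := by
  by_contra! hunb
  -- The norm need not be homogeneous, so the scaled vector itself is made small: `(1 / 2) ^ n` for
  -- summability, `(1 / 2) ^ k` for convergence to zero.
  have hz : ∀ n k : ℕ, ∃ z : X, (k : ℝ) < f z ∧
      ‖(2 : ℝ) ^ n • (z - c)‖ < (1 / 2 : ℝ) ^ n * (1 / 2 : ℝ) ^ k := by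
    intro n k
    have hcont : Tendsto (fun z : X => ‖(2 : ℝ) ^ n • (z - c)‖) (𝓝 c) (𝓝 0) := by
      have : Continuous fun z : X => ‖(2 : ℝ) ^ n • (z - c)‖ := by fun_prop
      simpa using this.tendsto c
    have hsmall := hcont.eventually_lt_const
      (show (0 : ℝ) < (1 / 2 : ℝ) ^ n * (1 / 2 : ℝ) ^ k by positivity)
    obtain ⟨z, hz, hz'⟩ := ((hunb k).and_eventually hsmall).exists
    exact ⟨z, hz, hz'⟩
  choose z hfz hz using hz
  have hgeom : Tendsto (fun k : ℕ => (1 / 2 : ℝ) ^ k) atTop (𝓝 0) :=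
    tendsto_pow_atTop_nhds_zero_of_lt_one (by norm_num) (by norm_num)
  obtain ⟨x, d, hd, hxd⟩ := exists_eventually_forall_add_mem_of_not_isHaarMeager hB hBm
    (y := fun n k => (2 : ℝ) ^ n • (z n k - c)) (u := fun n => (1 / 2 : ℝ) ^ n)
    (summable_geometric_of_lt_one (by norm_num) (by norm_num))
    (fun n k => (hz n k).le.trans
      (mul_le_of_le_one_right (by positivity) (pow_le_one₀ (by norm_num) (by norm_num))))
    (fun n => squeeze_zero_norm (fun k => (hz n k).le) (by simpa using hgeom.const_mul _))
  have hd0 : Tendsto d atTop (𝓝 0) := squeeze_zero_norm hd hgeom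
  have hv : Tendsto (fun n : ℕ => (1 - (1 / 2 : ℝ) ^ n)⁻¹ • (c - (1 / 2 : ℝ) ^ n • (x - d n)))
      atTop (𝓝 c) := by
    have h1 : Tendsto (fun n : ℕ => (1 - (1 / 2 : ℝ) ^ n)⁻¹) atTop (𝓝 (1 - 0)⁻¹) :=
      (hgeom.const_sub 1).inv₀ (by norm_num)
    have h2 := h1.smul ((hgeom.smul (hd0.const_sub x)).const_sub c)
    simpa using h2
  obtain ⟨n, hxn, hvn, hn⟩ :=
    (hxd.and ((hv.eventually (hGo.mem_nhds hc)).and (eventually_ge_atTop 1))).exists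
  obtain ⟨M, hM⟩ := hfB
  -- Independent of `k`; `n ≥ 1` makes the inverted factor nonzero.
  set v := (1 - (1 / 2 : ℝ) ^ n)⁻¹ • (c - (1 / 2 : ℝ) ^ n • (x - d n)) with hvdef
  have hlt : (1 / 2 : ℝ) ^ n < 1 := pow_lt_one₀ (by norm_num) (by norm_num) (by omega)
  obtain ⟨k, hk⟩ := exists_nat_gt ((1 / 2 : ℝ) ^ n * M + (1 - (1 / 2 : ℝ) ^ n) * f v)
  have hcomb : ((1 / 2 : ℝ) ^ n) • (x - d n + (2 : ℝ) ^ n • (z n k - c)) +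
      (1 - (1 / 2 : ℝ) ^ n) • v = z n k := by
    have h21 : (1 / 2 : ℝ) ^ n * 2 ^ n = 1 := by rw [← mul_pow]; norm_num
    rw [hvdef, smul_inv_smul₀ (by linarith), smul_add, smul_smul, h21, one_smul]
    abel
  have hle := hf.dyadic_le hG (hBG (hxn k)) hvn n
  rw [hcomb] at hle
  have hle' := mul_le_mul_of_nonneg_left (hM (Set.mem_image_of_mem f (hxn k)))
    (show (0 : ℝ) ≤ (1 / 2 : ℝ) ^ n by positivity)
  linarith [hfz n k]

/-- The Bernstein–Doetsch theorem at a point. -/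
theorem IsMidpointConvexOn.continuousAt {X : Type*} [NormedAddCommGroup X] [Module ℝ X]
    [ContinuousSMul ℝ X] {G : Set X} (hGo : IsOpen G) (hG : Convex ℝ G)
    {f : X → ℝ} (hf : IsMidpointConvexOn G f) {c : X} (hc : c ∈ G) {M : ℝ}
    (hM : ∀ᶠ z in 𝓝 c, f z ≤ M) : ContinuousAt f c := by
  have key : ∀ n : ℕ, ∀ᶠ z in 𝓝 c, |f z - f c| ≤ (1 / 2 : ℝ) ^ n * (M - f c) := by
    intro n
    -- Dilating `z` away from `c` by `2 ^ n` stays where `f ≤ M`; contracting back shrinks the bound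
    -- on the increment by `2 ^ n`.
    have upper : ∀ w ∈ G, f w ≤ M → ∀ z : X, w = c + (2 : ℝ) ^ n • (z - c) →
        f z - f c ≤ (1 / 2 : ℝ) ^ n * (M - f c) := by
      rintro w hw hwM z rfl
      have h21 : (1 / 2 : ℝ) ^ n * 2 ^ n = 1 := by rw [← mul_pow]; norm_num
      have h := hf.dyadic_le hG hw hc n
      have e : ((1 / 2 : ℝ) ^ n) • (c + (2 : ℝ) ^ n • (z - c)) + (1 - (1 / 2 : ℝ) ^ n) • c = z := by
        rw [smul_add, smul_smul, h21, sub_smul]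
        module
      rw [e] at h
      have := mul_le_mul_of_nonneg_left hwM (show (0 : ℝ) ≤ (1 / 2 : ℝ) ^ n by positivity)
      linarith
    have t1 : Tendsto (fun z : X => c + (2 : ℝ) ^ n • (z - c)) (𝓝 c) (𝓝 c) := by
      have : Continuous fun z : X => c + (2 : ℝ) ^ n • (z - c) := by fun_prop
      simpa using this.tendsto c
    have t2 : Tendsto (fun z : X => c + c - z) (𝓝 c) (𝓝 c) := by
      have : Continuous fun z : X => c + c - z := by fun_prop
      simpa using this.tendsto c
    have good := (hGo.eventually_mem hc).and hM
    filter_upwards [good, t1.eventually good, t2.eventually good,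
      (t1.comp t2).eventually good] with z h1 h2 h3 h4
    have ub := upper _ h2.1 h2.2 z rfl
    -- The upper bound at the reflection of `z` in `c` yields the lower bound at `z`, as `c` is
    -- their midpoint.
    have lb := upper _ h4.1 h4.2 (c + c - z) rfl
    have hmid := hf z h1.1 _ h3.1
    have e : (1 / 2 : ℝ) • z + (1 / 2 : ℝ) • (c + c - z) = c := by module
    rw [e] at hmid
    rw [abs_le]
    constructor <;> linarith
  have hgeom : Tendsto (fun n : ℕ => (1 / 2 : ℝ) ^ n * (M - f c)) atTop (𝓝 0) := by
    simpa using (tendsto_pow_atTop_nhds_zero_of_lt_one (r := (1 / 2 : ℝ)) (by norm_num)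
      (by norm_num)).mul_const (M - f c)
  rw [ContinuousAt, Metric.tendsto_nhds]
  intro ε hε
  obtain ⟨n, hn⟩ := (hgeom.eventually_lt_const hε).exists
  filter_upwards [key n] with z hz
  exact lt_of_le_of_lt hz hn

theorem IsOpen.hasUniversalBaireProperty {X : Type*} [TopologicalSpace X] {A : Set X}
    (hA : IsOpen A) : HasUniversalBaireProperty A :=
  fun _ _ _ _ _ hg => (hA.preimage hg).baireMeasurableSet

theorem IsOpen.not_isHaarMeager {X : Type*} [TopologicalSpace X] [AddCommGroup X]
    [IsTopologicalAddGroup X] {A : Set X} (hA : IsOpen A) (hne : A.Nonempty) :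
    ¬ IsHaarMeager A := by
  rintro ⟨K, _, _, _, ⟨k⟩, g, hg, h⟩
  obtain ⟨a, ha⟩ := hne
  -- This translate contains `g k`, so its preimage is nonempty and open in a Baire space.
  have hopen : IsOpen ((fun b => (g k - a) + b) '' A) := isOpenMap_add_left _ _ hA
  exact not_isMeagre_of_isOpen (hopen.preimage hg) ⟨k, a, ha, by simp⟩ (h (g k - a))

/- A complete metric linear space is a real linear space `X` with a complete translation-invariant
metric for which scalar multiplication is continuous. `NormedAddCommGroup X` is precisely an
Abelian group with an invariant metric, given by a prenorm; no homogeneity of `‖·‖` is assumed.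
The function on `G` is represented by `f : X → ℝ`, of which only the values on `G` matter. -/
theorem corollaryc0 {X : Type*} [NormedAddCommGroup X] [Module ℝ X] [ContinuousSMul ℝ X]
    [CompleteSpace X] (G : Set X) (hGopen : IsOpen G) (hGconvex : Convex ℝ G)
    (hGne : G.Nonempty) (f : X → ℝ) (hf : IsMidpointConvexOn G f) :
    ContinuousOn f G ↔
      ∃ B : Set X, B ⊆ G ∧ HasUniversalBaireProperty B ∧ ¬ IsHaarMeager B ∧
        BddAbove (f '' B) := by
  constructor
  · intro hcont
    obtain ⟨c, hc⟩ := hGne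
    have hopen : IsOpen (G ∩ f ⁻¹' Set.Iio (f c + 1)) := hcont.isOpen_inter_preimage hGopen isOpen_Iio
    refine ⟨_, Set.inter_subset_left, hopen.hasUniversalBaireProperty,
      hopen.not_isHaarMeager ⟨c, hc, by simp⟩, f c + 1, ?_⟩
    rintro _ ⟨z, hz, rfl⟩
    exact le_of_lt hz.2
  · rintro ⟨B, hBG, hB, hBm, hfB⟩ c hc
    obtain ⟨M, hM⟩ := hf.exists_eventually_le hGopen hGconvex hBG hB hBm hfB c hc
    exact (hf.continuousAt hGopen hGconvex hc hM).continuousWithinAt
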